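/- Let $a\in(0,1)$, $b\ge 1-a$ and $c,d>0$ be real, and put $p=a+b$, $\beta=b(1-a)$ and $k=\beta(p+1)+p$. Let $F(u,v;w;z)=\sum_{n=0}^{\infty}\frac{(u)_n(v)_n}{(w)_n}\frac{z^n}{n!}$ for $|z|<1$, where $(u)_0=1$ and $(u)_n=u(u+1)\cdots(u+n-1)$, be the Gaussian hypergeometric function. If $0<\frac{c}{d}\le\frac{\beta+p}{k}$, then $$\sup\Bigl\{\delta\in(a-1,0)\;:\;F(a-1,b;a+b;1-x^c)<F(a-1-\delta,b+\delta;a+b;1-x^d)\ \text{ for all } x\in(0,1)\Bigr\}=\frac{a-b-1+\sqrt{(p-1)^2+4\beta c/d}}{2}.$$ In particular, the set on the left is non-empty. -/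

import Mathlib

open Set Filter Topology

/-! Write q = -AB. Since C = A+B+1 = p on both sides, both functions solve z(1-z)f'' + p(1-z)f' + qf
= 0, and only q depends on δ. Comparing slopes at x = 1 (`mul_le_mul_of_forall_lt`) forces
(1-a+δ)(b+δ) ≤ βc/d, and the larger root of the corresponding quadratic is the claimed value.

This value is attained. Put y = x^d and r = c/d < 1; at the root the second parameter is qr, so the
slopes agree at y = 1. There the ratio f(1-y^r)/g(1-y) equals 1, so it suffices that it be strictly
increasing (`comp_rpow_lt`), i.e. that a Wronskian be positive (`wronskian_pos`). With an
integrating factor, its derivative is controlled by the sign of p(1-z)f' + qf (`barrier_pos`) and a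
weighted AM-GM inequality. -/

/-! ### Hypergeometric series and their differential equation -/

/-- Termwise differentiation of a power series converging on the unit interval. -/
lemma hasSum_deriv_of_hasSum_powerSeries {κ : ℕ → ℝ} {f : ℝ → ℝ}
    (h : ∀ z, |z| < 1 → HasSum (fun n => κ n * z ^ n) (f z)) {z : ℝ} (hz : |z| < 1) :
    DifferentiableAt ℝ f z ∧ HasSum (fun n : ℕ => (n + 1) * κ (n + 1) * z ^ n) (deriv f z) := by
  have hp : HasFPowerSeriesOnBall f (FormalMultilinearSeries.ofScalars ℝ κ) 0 1 := by
    refine ⟨?_, one_pos, ?_⟩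
    · refine ENNReal.le_of_forall_nnreal_lt fun r hr => ?_
      have hr' : |(r : ℝ)| < 1 := by
        rw [abs_of_nonneg r.coe_nonneg]; exact_mod_cast hr
      refine FormalMultilinearSeries.le_radius_of_summable _ ?_
      refine (h _ hr').summable.norm.congr fun n => ?_
      rw [FormalMultilinearSeries.ofScalars_norm, norm_mul, norm_pow, Real.norm_eq_abs (r : ℝ),
        abs_of_nonneg r.coe_nonneg]
    · intro y hy
      have hy' : |y| < 1 := by
        simpa [Metric.mem_eball, edist_zero_right, ← ofReal_norm] using hy
      simpa [FormalMultilinearSeries.ofScalars_apply_eq, mul_comm] using h y hy'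
  have hmem : z ∈ Metric.eball (0 : ℝ) 1 := by
    simpa [Metric.mem_eball, edist_zero_right, ← ofReal_norm] using hz
  refine ⟨hp.differentiableOn.differentiableAt (Metric.isOpen_eball.mem_nhds hmem), ?_⟩
  have hs := (hp.fderiv.hasSum hmem).mapL (ContinuousLinearMap.apply ℝ ℝ (1 : ℝ))
  simp only [zero_add] at hs
  convert! hs using 2 with n
  have := (FormalMultilinearSeries.ofScalars ℝ κ).derivSeries_coeff_one n
  rw [ContinuousLinearMap.apply_apply, FormalMultilinearSeries.apply_eq_pow_smul_coeff]
  simp only [smul_eq_mul, _root_.smul_apply, this]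
  simp [FormalMultilinearSeries.coeff_ofScalars]
  ring

/-- The hypergeometric series converges on the unit interval. -/
lemma hasSum_ordinaryHypergeometric {A B C : ℝ} (habc : ∀ n : ℕ, (n : ℝ) ≠ -A ∧ (n : ℝ) ≠ -B ∧
    (n : ℝ) ≠ -C) {z : ℝ} (hz : |z| < 1) :
    HasSum (fun n => ordinaryHypergeometricCoefficient A B C n * z ^ n)
      (ordinaryHypergeometric A B C z) := by
  have hr := ordinaryHypergeometricSeries_radius_eq_one ℝ A B C habc
  have hmem : z ∈ Metric.eball (0 : ℝ) (ordinaryHypergeometricSeries ℝ A B C).radius := by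
    rw [hr]
    simpa [Metric.mem_eball, edist_zero_right, ← ofReal_norm] using hz
  have := FormalMultilinearSeries.hasSum _ hmem
  simp only [ordinaryHypergeometricSeries_apply_eq, smul_eq_mul] at this
  exact this

lemma ordinaryHypergeometricCoefficient_succ {A B C : ℝ} (hC : 0 < C) (n : ℕ) :
    (n + 1) * (n + C) * ordinaryHypergeometricCoefficient A B C (n + 1) =
      (n + A) * (n + B) * ordinaryHypergeometricCoefficient A B C n := by
  have h1 : (n + C : ℝ) ≠ 0 := by positivity
  have h2 : (n + 1 : ℝ) ≠ 0 := by positivity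
  have h3 := (ascPochhammer_pos n C hC).ne'
  have h4 : (n.factorial : ℝ) ≠ 0 := by positivity
  simp only [ordinaryHypergeometricCoefficient, ascPochhammer_succ_eval, Nat.factorial_succ]
  push_cast
  rw [add_comm C]
  field_simp
  ring

/-- In the coefficient recursion only the factor A at n = 0 is negative; A > -1 makes every later n
+ A positive. -/
lemma ordinaryHypergeometricCoefficient_succ_neg {A B C : ℝ} (hA : -1 < A) (hA' : A < 0)
    (hB : 0 < B) (hC : 0 < C) (n : ℕ) :
    ordinaryHypergeometricCoefficient A B C (n + 1) < 0 := by
  induction n with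
  | zero =>
    have h := ordinaryHypergeometricCoefficient_succ (A := A) (B := B) hC 0
    have h0 : ordinaryHypergeometricCoefficient A B C 0 = 1 := by
      simp [ordinaryHypergeometricCoefficient]
    rw [h0] at h
    push_cast at h
    have := mul_neg_of_neg_of_pos hA' hB
    by_contra! hn
    have := mul_nonneg hC.le hn
    linarith
  | succ n ih =>
    have h := ordinaryHypergeometricCoefficient_succ (A := A) (B := B) hC (n + 1)
    push_cast at h
    have hn' : (0 : ℝ) ≤ n := n.cast_nonneg
    have h1 : 0 < (n + 1 + A) * (n + 1 + B) := mul_pos (by linarith) (by linarith)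
    have h2 := mul_neg_of_pos_of_neg h1 ih
    by_contra! hn
    have : 0 ≤ ((n : ℝ) + 1 + 1) * (n + 1 + C) *
      ordinaryHypergeometricCoefficient A B C (n + 1 + 1) := by positivity
    linarith

/-- What the comparison uses about the zero-balanced-plus-one function `₂F₁ A B (A + B + 1)`:
it solves `z (1 - z) f'' + p (1 - z) f' + q f = 0`, is regular at `0` and decreasing. -/
structure IsDecreasingHypergeometric (p q : ℝ) (f f' f'' : ℝ → ℝ) : Prop where
  hasDerivAt : ∀ z, |z| < 1 → HasDerivAt f (f' z) z
  hasDerivAt' : ∀ z, |z| < 1 → HasDerivAt f' (f'' z) z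
  ode : ∀ z, |z| < 1 → z * (1 - z) * f'' z + p * (1 - z) * f' z + q * f z = 0
  map_zero : f 0 = 1
  deriv_neg : ∀ z, 0 ≤ z → z < 1 → f' z < 0

lemma isDecreasingHypergeometric_ordinaryHypergeometric {A B C q : ℝ} (hA : -1 < A) (hA' : A < 0)
    (hB : 0 < B) (hC : C = A + B + 1) (hq : q = -(A * B)) :
    IsDecreasingHypergeometric C q (ordinaryHypergeometric A B C)
      (deriv (ordinaryHypergeometric A B C)) (deriv (deriv (ordinaryHypergeometric A B C))) := by
  have hC0 : 0 < C := by linarith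
  set κ := ordinaryHypergeometricCoefficient A B C with hκ
  have habc : ∀ n : ℕ, (n : ℝ) ≠ -A ∧ (n : ℝ) ≠ -B ∧ (n : ℝ) ≠ -C := by
    intro n
    have hn : (0 : ℝ) ≤ n := n.cast_nonneg
    refine ⟨fun h => ?_, by linarith, by linarith⟩
    have h1 : (n : ℝ) < (1 : ℕ) := by push_cast; linarith
    have h2 : ((0 : ℕ) : ℝ) < n := by push_cast; linarith
    rw [Nat.cast_lt] at h1 h2
    omega
  have s0 := fun z (hz : |z| < 1) => hasSum_ordinaryHypergeometric habc hz
  have s1 := fun z (hz : |z| < 1) => hasSum_deriv_of_hasSum_powerSeries s0 hz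
  have s2 := fun z (hz : |z| < 1) =>
    hasSum_deriv_of_hasSum_powerSeries (κ := fun n : ℕ => (n + 1) * κ (n + 1))
      (fun z hz => (s1 z hz).2) hz
  refine ⟨fun z hz => (s1 z hz).1.hasDerivAt, fun z hz => (s2 z hz).1.hasDerivAt, ?_,
    ordinaryHypergeometric_zero _ _ _, ?_⟩
  · intro z hz
    have t0 := s0 z hz
    have t1 := (s1 z hz).2
    have t1z : HasSum (fun n : ℕ => n * κ n * z ^ n)
        (z * deriv (ordinaryHypergeometric A B C) z) := by
      rw [← hasSum_nat_add_iff' 1]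
      simp only [Finset.range_one, Finset.sum_singleton, Nat.cast_zero, zero_mul, sub_zero]
      convert! t1.mul_left z using 2 with n
      push_cast; ring
    have t2z : HasSum (fun n : ℕ => n * ((n + 1) * κ (n + 1)) * z ^ n)
        (z * deriv (deriv (ordinaryHypergeometric A B C)) z) := by
      rw [← hasSum_nat_add_iff' 1]
      simp only [Finset.range_one, Finset.sum_singleton, Nat.cast_zero, zero_mul, sub_zero]
      convert! ((s2 z hz).2.mul_left z) using 2 with n
      push_cast; ring
    have t2zz : HasSum (fun n : ℕ => n * (n - 1) * κ n * z ^ n)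
        (z * (z * deriv (deriv (ordinaryHypergeometric A B C)) z)) := by
      rw [← hasSum_nat_add_iff' 1]
      simp only [Finset.range_one, Finset.sum_singleton, Nat.cast_zero, zero_mul, sub_zero]
      convert! (t2z.mul_left z) using 2 with n
      push_cast; ring
    have key := (((t2z.sub t2zz).add (t1.mul_left C)).sub (t1z.mul_left C)).sub
      (t0.mul_left (A * B))
    -- With C = A+B+1, n(n-1) + Cn + AB factors as (n+A)(n+B), so this is the recursion.
    have hzero : ∀ n : ℕ, n * ((n + 1) * κ (n + 1)) * z ^ n - n * (n - 1) * κ n * z ^ n +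
        C * ((n + 1) * κ (n + 1) * z ^ n) - C * (n * κ n * z ^ n) - A * B * (κ n * z ^ n) = 0 := by
      intro n
      have := ordinaryHypergeometricCoefficient_succ (A := A) (B := B) hC0 n
      rw [← hκ] at this
      subst hC
      linear_combination z ^ n * this
    have := key.unique ((hasSum_zero).congr_fun hzero)
    rw [hq]
    linear_combination this
  · intro z hz0 hz1
    have t1 := (s1 z (by rwa [abs_of_nonneg hz0])).2
    have hle : ∀ n : ℕ, (n + 1) * κ (n + 1) * z ^ n ≤ 0 := fun n =>
      mul_nonpos_of_nonpos_of_nonneg (mul_nonpos_of_nonneg_of_nonpos (by positivity)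
        (ordinaryHypergeometricCoefficient_succ_neg hA hA' hB hC0 n).le) (by positivity)
    refine hasSum_lt (i := 0) hle ?_ t1 hasSum_zero
    simpa using ordinaryHypergeometricCoefficient_succ_neg hA hA' hB hC0 0

/-! ### Comparison of solutions -/

/-- Weighted AM-GM, y^(1-r) ≤ (1-r)y + r, multiplied by y^r. -/
lemma le_mul_rpow_div_one_sub_rpow {r y : ℝ} (hr0 : 0 < r) (hr1 : r < 1) (hy0 : 0 < y) (hy1 : y < 1) :
    y ≤ (1 - y) * r * y ^ r / (1 - y ^ r) := by
  have h0 : 0 < y ^ r := Real.rpow_pos_of_pos hy0 r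
  have h1 : y ^ r < 1 := Real.rpow_lt_one hy0.le hy1 hr0
  rw [le_div_iff₀ (by linarith)]
  have h := Real.geom_mean_le_arith_mean2_weighted (sub_nonneg.2 hr1.le) hr0.le hy0.le zero_le_one
    (by ring)
  rw [Real.one_rpow, mul_one] at h
  have hy : y = y ^ (1 - r) * y ^ r := by
    rw [← Real.rpow_add hy0, sub_add_cancel, Real.rpow_one]
  have := mul_le_mul_of_nonneg_right h h0.le
  rw [← hy] at this
  linarith

namespace IsDecreasingHypergeometric

variable {p q q₁ q₂ r : ℝ} {f f' f'' g g' g'' : ℝ → ℝ}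

lemma deriv_zero (hf : IsDecreasingHypergeometric p q f f' f'') (hp : 0 < p) : f' 0 = -(q / p) := by
  have h := hf.ode 0 (by simp)
  rw [hf.map_zero] at h
  field_simp
  linarith

/-- Call the expression h. The equation gives (z^p h)' = (p-q) z^p (-f') > 0, and z^p h vanishes at
0. -/
lemma barrier_pos (hf : IsDecreasingHypergeometric p q f f' f'') (hp : 0 < p) (hq : q < p)
    {z : ℝ} (hz0 : 0 < z) (hz1 : z < 1) : 0 < p * (1 - z) * f' z + q * f z := by
  have hd : ∀ t, 0 ≤ t → t < 1 → HasDerivAt (fun z => p * (1 - z) * f' z + q * f z)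
      (p * (0 - 1) * f' t + p * (1 - t) * f'' t + q * f' t) t := fun t ht0 ht1 => by
    have ht : |t| < 1 := by rwa [abs_of_nonneg ht0]
    exact ((((hasDerivAt_const t 1).sub (hasDerivAt_id t)).const_mul p).mul
      (hf.hasDerivAt' t ht)).add ((hf.hasDerivAt t ht).const_mul q)
  have hmono : StrictMonoOn (fun z => z ^ p * (p * (1 - z) * f' z + q * f z)) (Icc 0 z) := by
    refine strictMonoOn_of_deriv_pos (convex_Icc 0 z) ?_ ?_
    · intro t ht
      exact ((Real.continuousAt_rpow_const t p (Or.inr hp.le)).mul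
        (hd t ht.1 (ht.2.trans_lt hz1)).continuousAt).continuousWithinAt
    · intro t ht
      rw [interior_Icc] at ht
      have ht1 := ht.2.trans hz1
      have hD : HasDerivAt (fun z => z ^ p * (p * (1 - z) * f' z + q * f z)) _ t :=
        (Real.hasDerivAt_rpow_const (Or.inl ht.1.ne')).mul (hd t ht.1.le ht1)
      rw [hD.deriv]
      have hpow : t ^ p = t ^ (p - 1) * t := by
        rw [← Real.rpow_add_one ht.1.ne', sub_add_cancel]
      have hode := hf.ode t (by rw [abs_of_pos ht.1]; exact ht1)
      have hneg := hf.deriv_neg t ht.1.le ht1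
      have hpos : 0 < t ^ (p - 1) := Real.rpow_pos_of_pos ht.1 _
      have : 0 < t ^ (p - 1) * (t * ((p - q) * -f' t)) :=
        mul_pos hpos (mul_pos ht.1 (mul_pos (by linarith) (by linarith)))
      refine this.trans_eq ?_
      rw [hpow]
      linear_combination (-(t ^ (p - 1)) * p) * hode
  have := hmono (left_mem_Icc.2 hz0.le) (right_mem_Icc.2 hz0.le) hz0
  simp only [Real.zero_rpow hp.ne', zero_mul] at this
  exact pos_of_mul_pos_right this (Real.rpow_nonneg hz0.le _)

lemma pos (hf : IsDecreasingHypergeometric p q f f' f'') (hp : 0 < p) (hq0 : 0 < q) (hq : q < p)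
    {z : ℝ} (hz0 : 0 ≤ z) (hz1 : z < 1) : 0 < f z := by
  rcases hz0.eq_or_lt with rfl | hz0
  · rw [hf.map_zero]; exact one_pos
  · have h := hf.barrier_pos hp hq hz0 hz1
    have : 0 < p * (1 - z) * -f' z :=
      mul_pos (mul_pos hp (by linarith)) (by linarith [hf.deriv_neg z hz0.le hz1])
    exact pos_of_mul_pos_right (by linarith : 0 < q * f z) hq0.le

lemma hasDerivAt_comp_rpow (hf : IsDecreasingHypergeometric p q f f' f'') (hr : 0 < r) {y : ℝ}
    (hy0 : 0 < y) (hy1 : y ≤ 1) :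
    HasDerivAt (fun y => f (1 - y ^ r)) (-(r * y ^ (r - 1)) * f' (1 - y ^ r)) y := by
  have h0 : 0 < y ^ r := Real.rpow_pos_of_pos hy0 r
  have h1 : y ^ r ≤ 1 := Real.rpow_le_one hy0.le hy1 hr.le
  have := (hf.hasDerivAt (1 - y ^ r) (by rw [abs_lt]; constructor <;> linarith)).comp y
    ((Real.hasDerivAt_rpow_const (p := r) (Or.inl hy0.ne')).const_sub 1)
  convert! this using 1
  ring

lemma hasDerivAt_deriv_comp_rpow (hf : IsDecreasingHypergeometric p q f f' f'') (hr : 0 < r) {y : ℝ}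
    (hy0 : 0 < y) (hy1 : y ≤ 1) :
    HasDerivAt (fun y => f' (1 - y ^ r)) (-(r * y ^ (r - 1)) * f'' (1 - y ^ r)) y := by
  have h0 : 0 < y ^ r := Real.rpow_pos_of_pos hy0 r
  have h1 : y ^ r ≤ 1 := Real.rpow_le_one hy0.le hy1 hr.le
  have := (hf.hasDerivAt' (1 - y ^ r) (by rw [abs_lt]; constructor <;> linarith)).comp y
    ((Real.hasDerivAt_rpow_const (p := r) (Or.inl hy0.ne')).const_sub 1)
  convert! this using 1
  ring

/-- The logarithmic derivative of `y ↦ f (1 - y ^ r)` dominates that of `y ↦ g (1 - y)`, stated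
through their Wronskian. -/
lemma wronskian_pos (hf : IsDecreasingHypergeometric p q f f' f'')
    (hg : IsDecreasingHypergeometric p (q * r) g g' g'') (hp : 0 < p) (hq0 : 0 < q) (hq : q < p)
    (hr0 : 0 < r) (hr1 : r < 1) {y : ℝ} (hy0 : 0 < y) (hy1 : y < 1) :
    0 < -(r * y ^ r) * f' (1 - y ^ r) * g (1 - y) + f (1 - y ^ r) * (y * g' (1 - y)) := by
  set E : ℝ → ℝ := fun y =>
    -(r * y ^ r) * f' (1 - y ^ r) * g (1 - y) + f (1 - y ^ r) * (y * g' (1 - y)) with hE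
  have hdE : ∀ t, 0 < t → t ≤ 1 → HasDerivAt E
      ((-(r * (r * t ^ (r - 1))) * f' (1 - t ^ r) +
          -(r * t ^ r) * (-(r * t ^ (r - 1)) * f'' (1 - t ^ r))) * g (1 - t) +
        -(r * t ^ r) * f' (1 - t ^ r) * (g' (1 - t) * (-1)) +
        (-(r * t ^ (r - 1)) * f' (1 - t ^ r) * (t * g' (1 - t)) +
          f (1 - t ^ r) * (1 * g' (1 - t) + t * (g'' (1 - t) * (-1))))) t := by
    intro t ht0 ht1
    have ht : |1 - t| < 1 := by rw [abs_lt]; constructor <;> linarith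
    have hs := (hasDerivAt_id t).const_sub 1
    have hg0 := (hg.hasDerivAt (1 - t) ht).comp t hs
    have hg1 := (hg.hasDerivAt' (1 - t) ht).comp t hs
    have hw := ((Real.hasDerivAt_rpow_const (p := r) (Or.inl ht0.ne')).const_mul r).neg
    exact ((hw.mul (hf.hasDerivAt_deriv_comp_rpow hr0 ht0 ht1)).mul hg0).add
      ((hf.hasDerivAt_comp_rpow hr0 ht0 ht1).mul ((hasDerivAt_id t).mul hg1))
  -- E/t is the Wronskian; the weight (1-t)^p cancels every g' term in the derivative and vanishes
  -- at t = 1.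
  have hanti : StrictAntiOn (fun t => (1 - t) ^ p * (E t / t)) (Icc y 1) := by
    refine strictAntiOn_of_deriv_neg (convex_Icc y 1) ?_ ?_
    · intro t ht
      have ht0 := hy0.trans_le ht.1
      exact (((continuousAt_const.sub continuousAt_id).rpow_const (Or.inr hp.le)).mul
        ((hdE t ht0 ht.2).continuousAt.div continuousAt_id ht0.ne')).continuousWithinAt
    · intro t ht
      rw [interior_Icc] at ht
      have ht0 := hy0.trans ht.1
      have ht1 := ht.2
      have h1t : 0 < 1 - t := by linarith
      have hd1 := ((hasDerivAt_id t).const_sub 1).rpow_const (p := p) (Or.inl h1t.ne')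
      have hD : HasDerivAt (fun t => (1 - t) ^ p * (E t / t)) _ t :=
        hd1.mul ((hdE t ht0 ht1.le).div (hasDerivAt_id t) ht0.ne')
      rw [hD.deriv]
      have hw0 : 0 < t ^ r := Real.rpow_pos_of_pos ht0 r
      have hw1 : t ^ r < 1 := Real.rpow_lt_one ht0.le ht1 hr0
      have hpow : (1 - t) ^ p = (1 - t) ^ (p - 1) * (1 - t) := by
        rw [← Real.rpow_add_one h1t.ne', sub_add_cancel]
      have hpos : 0 < (1 - t) ^ (p - 1) := Real.rpow_pos_of_pos h1t _
      have hodef := hf.ode (1 - t ^ r) (by rw [abs_lt]; constructor <;> linarith)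
      have hodeg := hg.ode (1 - t) (by rw [abs_lt]; constructor <;> linarith)
      have hneg := hf.deriv_neg (1 - t ^ r) (by linarith) (by linarith)
      have hbar := hf.barrier_pos hp hq (z := 1 - t ^ r) (by linarith) (by linarith)
      have hN := le_mul_rpow_div_one_sub_rpow hr0 hr1 ht0 ht1
      have hqr : q * r < p := by nlinarith
      have hgpos := hg.pos hp (mul_pos hq0 hr0) hqr (z := 1 - t) h1t.le (by linarith)
      simp only [hE, id, Real.rpow_sub_one ht0.ne' r, hpow]
      generalize (1 - t) ^ (p - 1) = P at *
      generalize t ^ r = w at *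
      generalize f (1 - w) = F at *
      generalize f' (1 - w) = F1 at *
      generalize f'' (1 - w) = F2 at *
      generalize g (1 - t) = G at *
      generalize g' (1 - t) = G1 at *
      generalize g'' (1 - t) = G2 at *
      have h1w : 0 < 1 - w := by linarith
      have hF2 : F2 = -(p * w * F1 + q * F) / ((1 - w) * w) := by
        field_simp
        linear_combination hodef
      have hG2 : G2 = -(p * t * G1 + q * r * G) / ((1 - t) * t) := by
        field_simp
        linear_combination hodeg
      -- After eliminating second derivatives, what remains is G times a term negative because r < 1
      -- and f' < 0, minus the AM-GM gap times the barrier at z = 1 - w.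
      have hneg' : P * (G * (r * w * F1 * ((1 - r) * (1 - t)) -
          r * ((1 - t) * r * w / (1 - w) - t) * (p * (1 - (1 - w)) * F1 + q * F))) / t ^ 2 < 0 := by
        refine div_neg_of_neg_of_pos (mul_neg_of_pos_of_neg hpos (mul_neg_of_pos_of_neg hgpos ?_))
          (by positivity)
        have e1 : r * w * F1 * ((1 - r) * (1 - t)) < 0 :=
          mul_neg_of_neg_of_pos (mul_neg_of_pos_of_neg (by positivity) hneg)
            (mul_pos (by linarith) h1t)
        have e2 : 0 ≤ r * ((1 - t) * r * w / (1 - w) - t) * (p * (1 - (1 - w)) * F1 + q * F) :=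
          mul_nonneg (mul_nonneg hr0.le (by linarith)) hbar.le
        linarith
      refine lt_of_eq_of_lt ?_ hneg'
      rw [hF2, hG2]
      clear hF2 hG2 hodef hodeg hN hbar hneg'
      field_simp
      ring
  have := hanti (left_mem_Icc.2 hy1.le) (right_mem_Icc.2 hy1.le) hy1
  simp only [sub_self, Real.zero_rpow hp.ne', zero_mul] at this
  have h2 := pos_of_mul_pos_right this (Real.rpow_nonneg (sub_nonneg.2 hy1.le) _)
  exact (div_pos_iff_of_pos_right hy0).1 h2

lemma comp_rpow_lt (hf : IsDecreasingHypergeometric p q f f' f'')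
    (hg : IsDecreasingHypergeometric p (q * r) g g' g'') (hp : 0 < p) (hq0 : 0 < q) (hq : q < p)
    (hr0 : 0 < r) (hr1 : r < 1) {y : ℝ} (hy0 : 0 < y) (hy1 : y < 1) :
    f (1 - y ^ r) < g (1 - y) := by
  have hqr : q * r < p := by nlinarith
  have hgpos : ∀ t, 0 < t → t ≤ 1 → 0 < g (1 - t) := fun t ht0 ht1 =>
    hg.pos hp (mul_pos hq0 hr0) hqr (by linarith) (by linarith)
  have hd : ∀ t, 0 < t → t ≤ 1 → HasDerivAt (fun t => f (1 - t ^ r) / g (1 - t))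
      ((-(r * t ^ (r - 1)) * f' (1 - t ^ r) * g (1 - t) - f (1 - t ^ r) * (g' (1 - t) * (-1))) /
        g (1 - t) ^ 2) t := fun t ht0 ht1 =>
    (hf.hasDerivAt_comp_rpow hr0 ht0 ht1).div
      ((hg.hasDerivAt (1 - t) (by rw [abs_lt]; constructor <;> linarith)).comp t
        ((hasDerivAt_id t).const_sub 1)) (hgpos t ht0 ht1).ne'
  have hmono : StrictMonoOn (fun t => f (1 - t ^ r) / g (1 - t)) (Icc y 1) := by
    refine strictMonoOn_of_deriv_pos (convex_Icc y 1)
      (fun t ht => (hd t (hy0.trans_le ht.1) ht.2).continuousAt.continuousWithinAt) fun t ht => ?_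
    rw [interior_Icc] at ht
    have ht0 := hy0.trans ht.1
    rw [(hd t ht0 ht.2.le).deriv]
    refine div_pos ?_ (pow_pos (hgpos t ht0 ht.2.le) 2)
    have hW := div_pos (hf.wronskian_pos hg hp hq0 hq hr0 hr1 ht0 ht.2) ht0
    refine hW.trans_eq ?_
    rw [Real.rpow_sub_one ht0.ne']
    field_simp
    ring
  have := hmono (left_mem_Icc.2 hy1.le) (right_mem_Icc.2 hy1.le) hy1
  simp only [Real.one_rpow, sub_self, hf.map_zero, hg.map_zero, div_one] at this
  rwa [div_lt_one (hgpos y hy0 hy1.le)] at this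

/-- Comparing the slopes at `x = 1`. -/
lemma mul_le_mul_of_forall_lt (hf : IsDecreasingHypergeometric p q₁ f f' f'')
    (hg : IsDecreasingHypergeometric p q₂ g g' g'') (hp : 0 < p) {c d : ℝ} (hc : 0 < c)
    (hd : 0 < d) (h : ∀ x ∈ Ioo (0 : ℝ) 1, f (1 - x ^ c) < g (1 - x ^ d)) : q₂ * d ≤ q₁ * c := by
  have hder := (hg.hasDerivAt_comp_rpow hd one_pos le_rfl).sub
    (hf.hasDerivAt_comp_rpow hc one_pos le_rfl)
  simp only [Real.one_rpow, sub_self, hf.deriv_zero hp, hg.deriv_zero hp] at hder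
  have hle := le_of_tendsto ((hasDerivWithinAt_iff_tendsto_slope' (s := Iio 1) (by simp)).1
    hder.hasDerivWithinAt) (b := 0) (by
      filter_upwards [Ioo_mem_nhdsLT (zero_lt_one' ℝ)] with x hx
      rw [slope_def_field]
      refine div_nonpos_of_nonneg_of_nonpos ?_ (by linarith [hx.2])
      have := h x hx
      simp only [Pi.sub_apply, Real.one_rpow, sub_self, hf.map_zero, hg.map_zero, sub_zero]
      linarith)
  have : q₂ * d / p ≤ q₁ * c / p := by
    linarith [show -(d * 1) * -(q₂ / p) - -(c * 1) * -(q₁ / p) = q₂ * d / p - q₁ * c / p by ring]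
  exact (div_le_div_iff_of_pos_right hp).1 this

end IsDecreasingHypergeometric

theorem theorem1p2 (a b c d : ℝ) (ha₀ : 0 < a) (ha₁ : a < 1) (hb : 1 - a ≤ b)
    (hc : 0 < c) (hd : 0 < d)
    (hcd : c / d ≤ (b * (1 - a) + (a + b)) / (b * (1 - a) * (a + b + 1) + (a + b))) :
    IsLUB
      {δ : ℝ | δ ∈ Set.Ioo (a - 1) 0 ∧
        ∀ x ∈ Set.Ioo (0 : ℝ) 1,
          ordinaryHypergeometric (a - 1) b (a + b) (1 - x ^ c) <
            ordinaryHypergeometric (a - 1 - δ) (b + δ) (a + b) (1 - x ^ d)}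
      ((a - b - 1 + Real.sqrt ((a + b - 1) ^ 2 + 4 * (b * (1 - a)) * (c / d))) / 2) := by
  have hb0 : 0 < b := by linarith
  have hp : 0 < a + b := by linarith
  have hq0 : 0 < b * (1 - a) := mul_pos hb0 (by linarith)
  have hqp : b * (1 - a) < a + b := by nlinarith
  have hr0 : 0 < c / d := div_pos hc hd
  have hr1 : c / d < 1 := by
    refine hcd.trans_lt ((div_lt_one (by positivity)).2 ?_)
    linarith [mul_pos hq0 hp]
  have hf := isDecreasingHypergeometric_ordinaryHypergeometric (A := a - 1) (B := b) (C := a + b)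
    (q := b * (1 - a)) (by linarith) (by linarith) hb0 (by ring) (by ring)
  have hg := fun δ (hδ : δ ∈ Ioo (a - 1) 0) =>
    isDecreasingHypergeometric_ordinaryHypergeometric (A := a - 1 - δ) (B := b + δ)
      (C := a + b) (q := (1 - a + δ) * (b + δ)) (by linarith [hδ.2]) (by linarith [hδ.1])
      (by linarith [hδ.1]) (by ring) (by ring)
  set S := Real.sqrt ((a + b - 1) ^ 2 + 4 * (b * (1 - a)) * (c / d)) with hS
  have hSsq : S ^ 2 = (a + b - 1) ^ 2 + 4 * (b * (1 - a)) * (c / d) := Real.sq_sqrt (by positivity)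
  have hSlow : a + b - 1 < S := Real.lt_sqrt_of_sq_lt (by linarith [mul_pos hq0 hr0])
  have hShigh : S < b + 1 - a := by
    rw [hS, Real.sqrt_lt' (by linarith)]
    linarith [mul_lt_mul_of_pos_left hr1 hq0]
  refine IsGreatest.isLUB ⟨⟨⟨by linarith, by linarith⟩, ?_⟩, ?_⟩
  · intro x hx
    have hgS := hg ((a - b - 1 + S) / 2) ⟨by linarith, by linarith⟩
    -- The two factors are (S ∓ (a+b-1))/2.
    have hqS : (1 - a + (a - b - 1 + S) / 2) * (b + (a - b - 1 + S) / 2) =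
        b * (1 - a) * (c / d) := by
      linear_combination hSsq / 4
    rw [hqS] at hgS
    have := hf.comp_rpow_lt hgS hp hq0 hqp hr0 hr1 (Real.rpow_pos_of_pos hx.1 d)
      (Real.rpow_lt_one hx.1.le hx.2 hd)
    rwa [← Real.rpow_mul hx.1.le, mul_div_cancel₀ _ hd.ne'] at this
  · rintro δ ⟨hδ, h⟩
    have hle := hf.mul_le_mul_of_forall_lt (hg δ hδ) hp hc hd h
    have hle' : (1 - a + δ) * (b + δ) ≤ b * (1 - a) * (c / d) := by
      rw [← mul_div_assoc, le_div_iff₀ hd]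
      exact hle
    -- (u+v)² = 4uv + (u-v)² with u = 1-a+δ, v = b+δ.
    have : 2 * δ + (b + 1 - a) ≤ S := Real.le_sqrt_of_sq_le (by linarith)
    linarith
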